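/- Let $n\ge 1$ and let $\nu$ be a nonzero, locally finite Borel measure on $\mathbb R^n$ which is convex, i.e. $$\nu((1-\lambda)A+\lambda B)\ \ge\ \min(\nu(A),\nu(B))$$ for all $\lambda\in[0,1]$ and all compact sets $A,B\subset\mathbb R^n$ with $\nu(A)\nu(B)>0$. Assume that $\nu$ has an even density with respect to Lebesgue measure. Then $\nu$ has an even density $\psi:\mathbb R^n\to[0,\infty)$ which is $-1/n$-concave (that is, $\psi$ is not identically zero, $\{\psi>0\}$ is convex and $\psi^{-1/n}$ is convex on $\{\psi>0\}$). For every such density $\psi$, consider the function $\Phi$ given by $\Phi(0)=0$ and, for $z\ne0$, $$\Phi(z)=\frac{|z|}{\int_{z^\perp}\psi(x)\,dx},$$ where $|\cdot|$ is the Euclidean norm, $dx$ is Lebesgue measure on the hyperplane $z^\perp$, and $|z|/\infty=0$. Then $\Phi$ is a (finite-valued) seminorm on $\mathbb R^n$, and it is a norm if and only if $\int_{z^\perp}\psi(x)\,dx<\infty$ for every $z\neq0$. -/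

import Mathlib

open MeasureTheory Set
open scoped ENNReal Pointwise

/-- A Borel measure `μ` is *convex* (that is, `(-∞)`-concave) if
`μ ((1 - t) A + t B) ≥ min (μ A) (μ B)` for all compact sets `A`, `B` of positive measure and all
`t ∈ [0, 1]`. -/
def IsConvexMeasure {n : ℕ} (μ : Measure (EuclideanSpace ℝ (Fin n))) : Prop :=
  ∀ A B : Set (EuclideanSpace ℝ (Fin n)), IsCompact A → IsCompact B → 0 < μ A * μ B →
    ∀ t : ℝ, 0 ≤ t → t ≤ 1 → min (μ A) (μ B) ≤ μ ((1 - t) • A + t • B)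

/-- A nonnegative, not identically zero function `ψ` is *`γ`-concave* if, on the convex set
`{ψ > 0}`, `ψ ^ γ` is concave (`γ > 0`), `log ψ` is concave (`γ = 0`), `ψ ^ γ` is convex
(`γ < 0`). -/
structure IsGammaConcave {n : ℕ} (γ : ℝ) (ψ : EuclideanSpace ℝ (Fin n) → ℝ) : Prop where
  nonneg : ∀ x, 0 ≤ ψ x
  ne_zero : ∃ x, ψ x ≠ 0
  pos : 0 < γ → ConcaveOn ℝ {x | 0 < ψ x} (fun x => ψ x ^ γ)
  zero : γ = 0 → ConcaveOn ℝ {x | 0 < ψ x} (fun x => Real.log (ψ x))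
  neg : γ < 0 → ConvexOn ℝ {x | 0 < ψ x} (fun x => ψ x ^ γ)

/-- `ψ ≥ 0` is a density of `ν` with respect to Lebesgue measure: `dν(x) = ψ(x) dx`. -/
structure IsDensity {n : ℕ} (ν : Measure (EuclideanSpace ℝ (Fin n)))
    (ψ : EuclideanSpace ℝ (Fin n) → ℝ) : Prop where
  nonneg : ∀ x, 0 ≤ ψ x
  aemeasurable : AEMeasurable ψ volume
  eq_withDensity : ν = volume.withDensity (fun x => ENNReal.ofReal (ψ x))

/-- `∫_{z^⊥} ψ(x) dx ∈ [0, ∞]`, where `dx` is Lebesgue measure on the Euclidean space `z^⊥`. -/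
noncomputable def hyperplaneMeasure {n : ℕ} (ψ : EuclideanSpace ℝ (Fin n) → ℝ)
    (z : EuclideanSpace ℝ (Fin n)) : ℝ≥0∞ :=
  ∫⁻ x : ↥(ℝ ∙ z)ᗮ, ENNReal.ofReal (ψ (x : EuclideanSpace ℝ (Fin n)))
    ∂(@volume _ measureSpaceOfInnerProductSpace)

/-- `Φ(z) = |z| / ∫_{z^⊥} ψ`, computed in `[0, ∞]` (so `|z| / ∞ = 0`, `|z| / 0 = ∞` for
`z ≠ 0`), with `Φ(0) = 0`. -/
noncomputable def busemannFun {n : ℕ} (ψ : EuclideanSpace ℝ (Fin n) → ℝ)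
    (z : EuclideanSpace ℝ (Fin n)) : ℝ≥0∞ :=
  if z = 0 then 0 else ENNReal.ofReal ‖z‖ / hyperplaneMeasure ψ z

/-- `Φ` takes finite values and is a seminorm. -/
def IsSeminormFun {n : ℕ} (Φ : EuclideanSpace ℝ (Fin n) → ℝ≥0∞) : Prop :=
  ∃ p : Seminorm ℝ (EuclideanSpace ℝ (Fin n)), ∀ z, Φ z = ENNReal.ofReal (p z)

/-- `Φ` takes finite values and is a norm. -/
def IsNormFun {n : ℕ} (Φ : EuclideanSpace ℝ (Fin n) → ℝ≥0∞) : Prop :=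
  ∃ p : Seminorm ℝ (EuclideanSpace ℝ (Fin n)),
    (∀ z, Φ z = ENNReal.ofReal (p z)) ∧ ∀ z, p z = 0 → z = 0

/-!
The existence of a `-1/n`-concave density is Borell's theorem. Take as density the lower limit `D` of
the ratios `ν (B(x, r)) / |B(x, r)|`; it agrees with every density almost everywhere by Lebesgue
differentiation. If `D x > a` and `D y > b`, the balls around `x` and `y` with radii `r a ^ (-1/n)`
and `r b ^ (-1/n)` both have `ν`-measure at least `|B(0, r)|`, and their Minkowski combinations are
balls, so the convexity of `ν` is precisely the `-1/n`-concavity of `D`, at every point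
(`IsConvexMeasure.ennrealNegConcave_lowerDensity`). If `D x = ∞`, concavity along the rays from `x`
shows that all balls around `x` have the same measure, which is impossible for a nonzero measure
without atoms (`IsConvexMeasure.lowerDensity_ne_top`).

The triangle inequality for `Φ` is a Busemann type theorem. Let `y`, `z` be linearly independent, let
`P` be their span, `m = n - 2`, `e` the parametrization of `Pᗮ` by `ℝ^m` given by an orthonormal
basis, and `J` the rotation of `P` by a right angle. For `x ∈ P` the hyperplane `xᗮ` is spanned by `J x` and `Pᗮ`, so evenness gives
`1 / Φ(x) = 2 ∫_{t > 0} ∫ ψ (t J x + e w) dw dt`. In the projective coordinates `s = 1 / t`,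
`w' = w / t` the integrand becomes `G_x (s, w') = s ^ (-n) ψ ((J x + e w') / s)`, and the perspective
of the convex function `ψ ^ (-1/n)` is subadditive:
`G_{y+z} (q + r) ^ (-1/n) ≤ G_y (q) ^ (-1/n) + G_z (r) ^ (-1/n)` (`projectiveIntegrand_add_le`).
The homogeneous Borell–Brascamp–Lieb inequality in dimension `n - 1` (`BorellBrascampLieb`) turns
this into `1 / ∫ G_{y+z} ≤ 1 / ∫ G_y + 1 / ∫ G_z`, the required inequality. It is proved in
dimension one from the Brunn–Minkowski inequality on superlevel sets and tensorizes by Tonelli's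
theorem, each dimension lowering the exponent by one.

The function `ψ` itself need not be measurable on hyperplanes. It is replaced by its restriction to
the interior of `{ψ > 0}`, where it is continuous; the boundary of a convex set is null in each
hyperplane through the interior point `0`. Since `ψ` is positive near `0`, the hyperplane integrals
are positive, that is, `Φ` is finite.
-/

/-! ### The one-dimensional Brunn–Minkowski inequality and its integrated form -/

theorem Real.volume_add_volume_le_of_isCompact {K L : Set ℝ} (hK : IsCompact K) (hL : IsCompact L)
    (hK' : K.Nonempty) (hL' : L.Nonempty) : volume K + volume L ≤ volume (K + L) := by
  set k := sSup K
  set l := sInf L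
  have hk : k ∈ K := hK.sSup_mem hK'
  have hl : l ∈ L := hL.sInf_mem hL'
  -- The translates `K + min L` and `max K + L` of `K` and `L` lie in `K + L` and share one point.
  have h1 : (fun x => x + l) '' K ∪ (fun x => k + x) '' L ⊆ K + L := by
    rintro _ (⟨x, hx, rfl⟩ | ⟨x, hx, rfl⟩)
    · exact add_mem_add hx hl
    · exact add_mem_add hk hx
  have h2 : (fun x => x + l) '' K ∩ (fun x => k + x) '' L ⊆ {k + l} := by
    rintro _ ⟨⟨x, hx, rfl⟩, ⟨y, hy, hxy⟩⟩
    have := le_csSup hK.bddAbove hx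
    have := csInf_le hL.bddBelow hy
    simp only [mem_singleton_iff] at *
    linarith
  have h3 : volume ((fun x => x + l) '' K) = volume K := by
    simp
  have h4 : volume ((fun x => k + x) '' L) = volume L := by
    simp
  have hm : MeasurableSet ((fun x => k + x) '' L) :=
    (hL.image (by fun_prop)).measurableSet
  rw [← h3, ← h4, ← measure_union_add_inter _ hm, measure_mono_null h2 (by simp), add_zero]
  exact measure_mono h1

/-- The one-dimensional Brunn–Minkowski inequality. -/
theorem Real.volume_add_volume_le {A B : Set ℝ} (hA : MeasurableSet A) (hB : MeasurableSet B)
    (hA' : A.Nonempty) (hB' : B.Nonempty) : volume A + volume B ≤ volume (A + B) := by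
  obtain ⟨a, ha⟩ := hA'
  obtain ⟨b, hb⟩ := hB'
  rw [hA.measure_eq_iSup_isCompact, hB.measure_eq_iSup_isCompact]
  simp only [iSup_and']
  refine ENNReal.biSup_add_biSup_le' ⟨∅, by simp⟩ ⟨∅, by simp⟩ ?_
  rintro K ⟨hKA, hK⟩ L ⟨hLB, hL⟩
  -- The points `a` and `b` make the inner approximations nonempty when `A` or `B` is a null set.
  calc volume K + volume L ≤ volume (insert a K) + volume (insert b L) := by
        gcongr <;> exact subset_insert _ _
    _ ≤ volume (insert a K + insert b L) :=
        volume_add_volume_le_of_isCompact (hK.insert a) (hL.insert b) (by simp) (by simp)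
    _ ≤ volume (A + B) :=
        measure_mono (add_subset_add (insert_subset ha hKA) (insert_subset hb hLB))

/-- Layer cake formula for extended nonnegative functions. -/
theorem lintegral_eq_lintegral_meas_ofReal_lt {α : Type*} [MeasurableSpace α] (μ : Measure α)
    [SFinite μ] {f : α → ℝ≥0∞} (hf : Measurable f) :
    ∫⁻ x, f x ∂μ = ∫⁻ s in Ioi (0 : ℝ), μ {x | ENNReal.ofReal s < f x} := by
  have hS : MeasurableSet {q : α × ℝ | ENNReal.ofReal q.2 < f q.1} :=
    measurableSet_lt (by fun_prop) (by fun_prop)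
  have h1 : ∀ x, f x = ∫⁻ s in Ioi (0 : ℝ),
      {q : α × ℝ | ENNReal.ofReal q.2 < f q.1}.indicator 1 (x, s) := by
    intro x
    have hx : MeasurableSet {s : ℝ | ENNReal.ofReal s < f x} :=
      measurableSet_lt (by fun_prop) (by fun_prop)
    have : (fun s => {q : α × ℝ | ENNReal.ofReal q.2 < f q.1}.indicator (1 : α × ℝ → ℝ≥0∞) (x, s))
        = {s : ℝ | ENNReal.ofReal s < f x}.indicator 1 := by
      ext s; simp [indicator]
    rw [this, lintegral_indicator_one hx, Measure.restrict_apply hx]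
    rcases eq_or_ne (f x) ∞ with h | h
    · simp [h]
    · have : {s : ℝ | ENNReal.ofReal s < f x} ∩ Ioi 0 = Ioo 0 (f x).toReal := by
        ext s
        simp only [mem_inter_iff, mem_ofPred_eq, mem_Ioi, mem_Ioo]
        constructor
        · rintro ⟨h1, h2⟩
          exact ⟨h2, (ENNReal.ofReal_lt_iff_lt_toReal h2.le h).1 h1⟩
        · rintro ⟨h1, h2⟩
          exact ⟨(ENNReal.ofReal_lt_iff_lt_toReal h1.le h).2 h2, h1⟩
      rw [this, Real.volume_Ioo, sub_zero, ENNReal.ofReal_toReal h]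
  calc ∫⁻ x, f x ∂μ = ∫⁻ x, (∫⁻ s in Ioi (0 : ℝ),
        {q : α × ℝ | ENNReal.ofReal q.2 < f q.1}.indicator 1 (x, s)) ∂μ := lintegral_congr h1
    _ = _ := by
      rw [lintegral_lintegral_swap]
      · refine lintegral_congr fun s => ?_
        have hs : MeasurableSet {x | ENNReal.ofReal s < f x} :=
          measurableSet_lt (by fun_prop) (by fun_prop)
        rw [← lintegral_indicator_one hs]
        rfl
      · exact (measurable_one.indicator hS).aemeasurable

/-- If `f` and `g` have the same supremum, then all their nonempty superlevel sets come in pairs, so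
the Brunn–Minkowski inequality can be integrated over the levels. -/
theorem lintegral_add_lintegral_le_of_min_le {f g h : ℝ → ℝ≥0∞} (hf : Measurable f)
    (hg : Measurable g) (hh : Measurable h) (hsup : ⨆ x, f x = ⨆ x, g x)
    (hmin : ∀ x y, min (f x) (g y) ≤ h (x + y)) :
    (∫⁻ x, f x) + ∫⁻ x, g x ≤ ∫⁻ x, h x := by
  have hlev : ∀ {k : ℝ → ℝ≥0∞}, Measurable k → ∀ s : ℝ, MeasurableSet {x | ENNReal.ofReal s < k x} :=
    fun hk s => measurableSet_lt (by fun_prop) hk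
  have hmeas : Measurable fun s : ℝ => volume {x | ENNReal.ofReal s < f x} := by
    refine Antitone.measurable fun s t hst => measure_mono fun x hx => ?_
    exact (ENNReal.ofReal_le_ofReal hst).trans_lt hx
  rw [lintegral_eq_lintegral_meas_ofReal_lt _ hf, lintegral_eq_lintegral_meas_ofReal_lt _ hg,
    lintegral_eq_lintegral_meas_ofReal_lt _ hh, ← lintegral_add_left hmeas]
  refine lintegral_mono fun s => ?_
  by_cases hs : ENNReal.ofReal s < ⨆ x, f x
  · have hs' : ENNReal.ofReal s < ⨆ x, g x := hsup ▸ hs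
    refine (Real.volume_add_volume_le (hlev hf s) (hlev hg s) (lt_iSup_iff.1 hs)
      (lt_iSup_iff.1 hs')).trans (measure_mono ?_)
    rintro _ ⟨x, hx, y, hy, rfl⟩
    exact (lt_min hx hy).trans_le (hmin x y)
  · have h1 : {x | ENNReal.ofReal s < f x} = ∅ :=
      eq_empty_of_forall_notMem fun x hx => hs (hx.trans_le (le_iSup f x))
    have h2 : {x | ENNReal.ofReal s < g x} = ∅ :=
      eq_empty_of_forall_notMem fun x hx => hs (hsup ▸ hx.trans_le (le_iSup g x))
    simp [h1, h2]

theorem ENNReal.rpow_neg_le_rpow_neg_iff {x y : ℝ≥0∞} {q : ℝ} (hq : 0 < q) :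
    y ^ (-q) ≤ x ^ (-q) ↔ x ≤ y := by
  rw [ENNReal.rpow_neg, ENNReal.rpow_neg, ENNReal.inv_le_inv, ENNReal.rpow_le_rpow_iff hq]

/-- Two-term Hölder inequality in the form that eliminates the weights `a + b = 1`. -/
theorem rpow_neg_le_add_of_weighted_le {p : ℝ} (hp : 1 < p) {a b : ℝ} (ha : 0 < a) (hb : 0 < b)
    (hab : a + b = 1) {A B C : ℝ≥0∞}
    (h : ENNReal.ofReal (a ^ p) * A + ENNReal.ofReal (b ^ p) * B ≤ C) :
    C ^ (-(p - 1)⁻¹) ≤ A ^ (-(p - 1)⁻¹) + B ^ (-(p - 1)⁻¹) := by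
  have hp1 : 0 < p - 1 := by linarith
  have hq : 0 < (p - 1)⁻¹ := by positivity
  have hap : 0 < a ^ p := by positivity
  have hbp : 0 < b ^ p := by positivity
  rcases eq_or_ne A 0 with rfl | hA0
  · simp [ENNReal.zero_rpow_of_neg, hp]
  rcases eq_or_ne B 0 with rfl | hB0
  · simp [ENNReal.zero_rpow_of_neg, hp]
  rcases eq_or_ne C ∞ with rfl | hC
  · simp [ENNReal.top_rpow_of_neg, hp]
  rcases eq_or_ne A ∞ with rfl | hA
  · rw [ENNReal.mul_top (by simpa using hap), top_add, top_le_iff] at h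
    exact absurd h hC
  rcases eq_or_ne B ∞ with rfl | hB
  · rw [ENNReal.mul_top (by simpa using hbp), add_top, top_le_iff] at h
    exact absurd h hC
  refine ((ENNReal.rpow_neg_le_rpow_neg_iff hq).2 h).trans ?_
  obtain ⟨A, hA', rfl⟩ : ∃ x : ℝ, 0 < x ∧ A = ENNReal.ofReal x :=
    ⟨A.toReal, ENNReal.toReal_pos hA0 hA, (ENNReal.ofReal_toReal hA).symm⟩
  obtain ⟨B, hB', rfl⟩ : ∃ x : ℝ, 0 < x ∧ B = ENNReal.ofReal x :=
    ⟨B.toReal, ENNReal.toReal_pos hB0 hB, (ENNReal.ofReal_toReal hB).symm⟩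
  rw [← ENNReal.ofReal_mul hap.le, ← ENNReal.ofReal_mul hbp.le,
    ← ENNReal.ofReal_add (by positivity) (by positivity),
    ENNReal.ofReal_rpow_of_pos (by positivity), ENNReal.ofReal_rpow_of_pos hA',
    ENNReal.ofReal_rpow_of_pos hB', ← ENNReal.ofReal_add (by positivity) (by positivity)]
  apply ENNReal.ofReal_le_ofReal
  set X := A ^ (-(p - 1)⁻¹) with hX
  set Y := B ^ (-(p - 1)⁻¹) with hY
  have hX0 : 0 < X := by positivity
  have hY0 : 0 < Y := by positivity
  have hAX : A = X ^ (-(p - 1)) := by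
    rw [hX, ← Real.rpow_mul hA'.le]; field_simp; simp
  have hBY : B = Y ^ (-(p - 1)) := by
    rw [hY, ← Real.rpow_mul hB'.le]; field_simp; simp
  -- Convexity of `x ^ p` with the weights `X / (X + Y)` and `Y / (X + Y)`.
  have key : (X + Y) ^ (-(p - 1)) ≤ a ^ p * A + b ^ p * B := by
    have := (convexOn_rpow hp.le).2
      (show a * (X + Y) / X ∈ Ici 0 from mem_Ici.2 (by positivity))
      (show b * (X + Y) / Y ∈ Ici 0 from mem_Ici.2 (by positivity))
      (show 0 ≤ X / (X + Y) by positivity) (show 0 ≤ Y / (X + Y) by positivity)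
      (by field_simp)
    simp only [smul_eq_mul] at this
    rw [show X / (X + Y) * (a * (X + Y) / X) + Y / (X + Y) * (b * (X + Y) / Y) = 1 by
      field_simp; exact hab, Real.one_rpow] at this
    have e : ∀ {Z c : ℝ}, 0 < Z → 0 < c → Z / (X + Y) * (c * (X + Y) / Z) ^ p
        = (c ^ p * Z ^ (-(p - 1))) * (X + Y) ^ (p - 1) := by
      intro Z c hZ hc
      rw [Real.div_rpow (by positivity) hZ.le, Real.mul_rpow hc.le (by positivity),
        Real.rpow_neg hZ.le, Real.rpow_sub_one hZ.ne', Real.rpow_sub_one (by positivity)]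
      field_simp
    rw [e hX0 ha, e hY0 hb, ← hAX, ← hBY, ← add_mul] at this
    rw [Real.rpow_neg (by positivity)]
    exact (inv_le_iff_one_le_mul₀ (by positivity)).2 this
  calc (a ^ p * A + b ^ p * B) ^ (-(p - 1)⁻¹) ≤ ((X + Y) ^ (-(p - 1))) ^ (-(p - 1)⁻¹) :=
        Real.rpow_le_rpow_of_nonpos (by positivity) key (by linarith)
    _ = X + Y := by
        rw [← Real.rpow_mul (by positivity)]
        field_simp
        simp

/-! ### The homogeneous Borell–Brascamp–Lieb inequality -/

/-- One-dimensional Borell–Brascamp–Lieb inequality for functions with positive finite suprema. The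
weights `a` and `b` are chosen such that `a ^ p * f` and `b ^ p * g` have the same supremum. -/
theorem borellBrascampLieb_real_of_iSup {p : ℝ} (hp : 1 < p) {f g h : ℝ → ℝ≥0∞}
    (hf : Measurable f) (hg : Measurable g) (hh : Measurable h)
    (hf0 : ⨆ x, f x ≠ 0) (hg0 : ⨆ x, g x ≠ 0) (hft : ⨆ x, f x ≠ ∞) (hgt : ⨆ x, g x ≠ ∞)
    (hfgh : ∀ x y, h (x + y) ^ (-p⁻¹) ≤ f x ^ (-p⁻¹) + g y ^ (-p⁻¹)) :
    (∫⁻ x, h x) ^ (-(p - 1)⁻¹) ≤ (∫⁻ x, f x) ^ (-(p - 1)⁻¹) + (∫⁻ x, g x) ^ (-(p - 1)⁻¹) := by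
  have hp0 : 0 < p := by linarith
  have hpi : 0 < p⁻¹ := by positivity
  obtain ⟨M, hM0, hM⟩ : ∃ M : ℝ, 0 < M ∧ ⨆ x, f x = ENNReal.ofReal M :=
    ⟨_, ENNReal.toReal_pos hf0 hft, (ENNReal.ofReal_toReal hft).symm⟩
  obtain ⟨N, hN0, hN⟩ : ∃ N : ℝ, 0 < N ∧ ⨆ x, g x = ENNReal.ofReal N :=
    ⟨_, ENNReal.toReal_pos hg0 hgt, (ENNReal.ofReal_toReal hgt).symm⟩
  -- Weights `a`, `b` proportional to `M ^ (-1/p)`, `N ^ (-1/p)` give `a ^ p * M = b ^ p * N`.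
  set F := M ^ (-p⁻¹) with hF
  set G := N ^ (-p⁻¹) with hG
  have hF0 : 0 < F := by positivity
  have hG0 : 0 < G := by positivity
  have hFM : F ^ p * M = 1 := by
    rw [hF, ← Real.rpow_mul hM0.le]; simp [hp0.ne', Real.rpow_neg_one, hM0.ne']
  have hGN : G ^ p * N = 1 := by
    rw [hG, ← Real.rpow_mul hN0.le]; simp [hp0.ne', Real.rpow_neg_one, hN0.ne']
  set a := F / (F + G) with ha
  set b := G / (F + G) with hb
  have ha0 : 0 < a := by positivity
  have hb0 : 0 < b := by positivity
  have hab : a + b = 1 := by rw [ha, hb]; field_simp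
  refine rpow_neg_le_add_of_weighted_le hp ha0 hb0 hab ?_
  rw [← lintegral_const_mul _ hf, ← lintegral_const_mul _ hg]
  refine lintegral_add_lintegral_le_of_min_le (hf.const_mul _) (hg.const_mul _) hh ?_ ?_
  · rw [← ENNReal.mul_iSup, ← ENNReal.mul_iSup, hM, hN, ← ENNReal.ofReal_mul (by positivity),
      ← ENNReal.ofReal_mul (by positivity), ha, hb, Real.div_rpow hF0.le (by positivity),
      Real.div_rpow hG0.le (by positivity), div_mul_eq_mul_div, hFM, div_mul_eq_mul_div, hGN]
  · intro x y
    set c := min (ENNReal.ofReal (a ^ p) * f x) (ENNReal.ofReal (b ^ p) * g y) with hc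
    -- It remains to see that `h (x + y) ^ (-1/p) ≤ c ^ (-1/p)`, using `a + b = 1`.
    have key : ∀ {w : ℝ} {u : ℝ≥0∞}, 0 < w → u ≠ ∞ → c ≤ ENNReal.ofReal (w ^ p) * u →
        u ^ (-p⁻¹) ≤ ENNReal.ofReal w * c ^ (-p⁻¹) := by
      intro w u hw hu hcu
      have h1 := (ENNReal.rpow_neg_le_rpow_neg_iff hpi).2 hcu
      rw [← ENNReal.ofReal_rpow_of_pos hw, ENNReal.mul_rpow_of_ne_top (by simp [hp0.le]) hu,
        ← ENNReal.rpow_mul, mul_neg, mul_inv_cancel₀ hp0.ne', ENNReal.rpow_neg_one] at h1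
      calc u ^ (-p⁻¹) = ENNReal.ofReal w * ((ENNReal.ofReal w)⁻¹ * u ^ (-p⁻¹)) := by
            rw [← mul_assoc, ENNReal.mul_inv_cancel (by simpa using hw) (by simp), one_mul]
        _ ≤ _ := by gcongr
    have hfx : f x ≠ ∞ := ne_top_of_le_ne_top hft (le_iSup f x)
    have hgy : g y ≠ ∞ := ne_top_of_le_ne_top hgt (le_iSup g y)
    refine (ENNReal.rpow_neg_le_rpow_neg_iff hpi).1 ((hfgh x y).trans ?_)
    calc f x ^ (-p⁻¹) + g y ^ (-p⁻¹)
        ≤ ENNReal.ofReal a * c ^ (-p⁻¹) + ENNReal.ofReal b * c ^ (-p⁻¹) :=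
          add_le_add (key ha0 hfx (min_le_left _ _)) (key hb0 hgy (min_le_right _ _))
      _ = c ^ (-p⁻¹) := by
          rw [← add_mul, ← ENNReal.ofReal_add ha0.le hb0.le, hab, ENNReal.ofReal_one, one_mul]

theorem tendsto_lintegral_min_natCast {α : Type*} [MeasurableSpace α] (μ : Measure α)
    {f : α → ℝ≥0∞} (hf : Measurable f) :
    Filter.Tendsto (fun k : ℕ => ∫⁻ x, min (f x) k ∂μ) Filter.atTop (nhds (∫⁻ x, f x ∂μ)) := by
  refine lintegral_tendsto_of_tendsto_of_monotone
    (fun k => (hf.min measurable_const).aemeasurable) ?_ ?_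
  · refine Filter.Eventually.of_forall fun x i j hij => ?_
    dsimp only
    gcongr
  · refine Filter.Eventually.of_forall fun x => ?_
    simpa using (tendsto_const_nhds (x := f x)).min ENNReal.tendsto_nat_nhds_top

/-- One-dimensional Borell–Brascamp–Lieb inequality in its homogeneous form. Truncating `f` and `g`
from above preserves the hypothesis and makes the suprema finite. -/
theorem borellBrascampLieb_real {p : ℝ} (hp : 1 < p) {f g h : ℝ → ℝ≥0∞}
    (hf : Measurable f) (hg : Measurable g) (hh : Measurable h)
    (hfgh : ∀ x y, h (x + y) ^ (-p⁻¹) ≤ f x ^ (-p⁻¹) + g y ^ (-p⁻¹)) :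
    (∫⁻ x, h x) ^ (-(p - 1)⁻¹) ≤ (∫⁻ x, f x) ^ (-(p - 1)⁻¹) + (∫⁻ x, g x) ^ (-(p - 1)⁻¹) := by
  have hq : -(p - 1)⁻¹ < 0 := by
    have : 0 < p - 1 := by linarith
    simpa using this
  have hpi : 0 < p⁻¹ := by positivity
  have hlim := (((ENNReal.continuous_rpow_const (y := -(p - 1)⁻¹)).tendsto _).comp
    (tendsto_lintegral_min_natCast volume hf)).add
    (((ENNReal.continuous_rpow_const (y := -(p - 1)⁻¹)).tendsto _).comp
    (tendsto_lintegral_min_natCast volume hg))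
  refine ge_of_tendsto hlim (Filter.Eventually.of_forall fun k => ?_)
  simp only [Function.comp_apply]
  have hzero : ∀ {u : ℝ → ℝ≥0∞}, ⨆ x, min (u x) k = 0 →
      (∫⁻ x, min (u x) k) ^ (-(p - 1)⁻¹) = ∞ := by
    intro u hu
    have : ∀ x, min (u x) k = 0 := fun x => le_antisymm (hu ▸ le_iSup (fun x => min (u x) k) x) bot_le
    simp only [this, lintegral_zero, ENNReal.zero_rpow_of_neg hq]
  have htop : ∀ {u : ℝ → ℝ≥0∞}, ⨆ x, min (u x) k ≠ ∞ := fun {u} =>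
    ne_top_of_le_ne_top (ENNReal.natCast_ne_top k) (iSup_le fun x => min_le_right _ _)
  by_cases hf0 : ⨆ x, min (f x) k = 0
  · rw [hzero hf0, top_add]; exact le_top
  by_cases hg0 : ⨆ x, min (g x) k = 0
  · rw [hzero hg0, add_top]; exact le_top
  refine borellBrascampLieb_real_of_iSup hp (hf.min measurable_const) (hg.min measurable_const) hh
    hf0 hg0 htop htop fun x y => (hfgh x y).trans (add_le_add ?_ ?_) <;>
  exact (ENNReal.rpow_neg_le_rpow_neg_iff hpi).2 (min_le_left _ _)

/-- The measure `μ` satisfies the homogeneous Borell–Brascamp–Lieb inequality in dimension `d`: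
if `h (x + y) ≥ (f x ^ (-1/p) + g y ^ (-1/p)) ^ (-p)` then the integrals satisfy the same relation
with `p` replaced by `p - d`. -/
def BorellBrascampLieb {α : Type*} [MeasurableSpace α] [Add α] (μ : Measure α) (d : ℕ) : Prop :=
  ∀ p : ℝ, d < p → ∀ f g h : α → ℝ≥0∞, Measurable f → Measurable g → Measurable h →
    (∀ x y, h (x + y) ^ (-p⁻¹) ≤ f x ^ (-p⁻¹) + g y ^ (-p⁻¹)) →
    (∫⁻ x, h x ∂μ) ^ (-(p - d)⁻¹) ≤ (∫⁻ x, f x ∂μ) ^ (-(p - d)⁻¹) + (∫⁻ x, g x ∂μ) ^ (-(p - d)⁻¹)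

theorem BorellBrascampLieb.real : BorellBrascampLieb (volume : Measure ℝ) 1 := by
  intro p hp f g h hf hg hh hfgh
  simp only [Nat.cast_one] at hp ⊢
  exact borellBrascampLieb_real hp hf hg hh hfgh

/-- Tensorization: integrate first over the second factor, then over the first one. -/
theorem BorellBrascampLieb.prod {α β : Type*} [MeasurableSpace α] [Add α] [MeasurableSpace β]
    [Add β] {μ : Measure α} {ν : Measure β} [SFinite μ] [SFinite ν] {d e : ℕ}
    (hμ : BorellBrascampLieb μ d) (hν : BorellBrascampLieb ν e) :
    BorellBrascampLieb (μ.prod ν) (d + e) := by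
  intro p hp f g h hf hg hh hfgh
  push_cast at hp ⊢
  have hd : (0 : ℝ) ≤ d := d.cast_nonneg
  rw [lintegral_prod _ hf.aemeasurable, lintegral_prod _ hg.aemeasurable,
    lintegral_prod _ hh.aemeasurable, show p - (d + e) = (p - e) - d by ring]
  refine hμ (p - e) (by linarith) _ _ _ hf.lintegral_prod_right' hg.lintegral_prod_right'
    hh.lintegral_prod_right' fun x₁ x₂ => ?_
  exact hν p (by linarith) _ _ _ (by fun_prop) (by fun_prop) (by fun_prop)
    fun y₁ y₂ => hfgh (x₁, y₁) (x₂, y₂)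

theorem BorellBrascampLieb.of_measurePreserving {α β : Type*} [MeasurableSpace α] [Add α]
    [MeasurableSpace β] [Add β] {μ : Measure α} {ν : Measure β} {d : ℕ}
    (hμ : BorellBrascampLieb μ d) (T : α → β) (hT : MeasurePreserving T μ ν)
    (hadd : ∀ x y, T (x + y) = T x + T y) : BorellBrascampLieb ν d := by
  intro p hp f g h hf hg hh hfgh
  rw [← hT.lintegral_comp hf, ← hT.lintegral_comp hg, ← hT.lintegral_comp hh]
  refine hμ p hp _ _ _ (hf.comp hT.measurable) (hg.comp hT.measurable) (hh.comp hT.measurable)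
    fun x y => ?_
  rw [hadd]
  exact hfgh _ _

theorem BorellBrascampLieb.pi (d : ℕ) : BorellBrascampLieb (volume : Measure (Fin d → ℝ)) d := by
  induction d with
  | zero =>
    intro p hp f g h hf hg hh hfgh
    have hint : ∀ u : (Fin 0 → ℝ) → ℝ≥0∞, ∫⁻ x, u x = u 0 := fun u => by
      rw [volume_pi, Measure.pi_of_empty, lintegral_dirac]
      exact congrArg u (Subsingleton.elim _ _)
    simpa [hint] using hfgh 0 0
  | succ d ih =>
    have hprod := BorellBrascampLieb.real.prod ih
    rw [Nat.add_comm 1 d] at hprod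
    refine hprod.of_measurePreserving
      (MeasurableEquiv.piFinSuccAbove (fun _ : Fin (d + 1) => ℝ) 0).symm
      (volume_preserving_piFinSuccAbove (fun _ : Fin (d + 1) => ℝ) 0).symm ?_
    rintro ⟨x, v⟩ ⟨y, w⟩
    ext i
    refine Fin.cases ?_ (fun j => ?_) i <;> simp [MeasurableEquiv.piFinSuccAbove]

/-! ### Half-space integrals in projective coordinates -/

theorem lintegral_comp_smul {E : Type*} [NormedAddCommGroup E] [NormedSpace ℝ E] [MeasurableSpace E]
    [BorelSpace E] [FiniteDimensional ℝ E] (μ : Measure E) [μ.IsAddHaarMeasure] (f : E → ℝ≥0∞)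
    {r : ℝ} (hr : 0 < r) :
    ENNReal.ofReal (r ^ Module.finrank ℝ E) * ∫⁻ x, f (r • x) ∂μ = ∫⁻ x, f x ∂μ := by
  have hpos : 0 < r ^ Module.finrank ℝ E := by positivity
  have h : ∫⁻ x, f (r • x) ∂μ = ∫⁻ x, f x ∂(μ.map (r • ·)) :=
    (lintegral_map_equiv f (Homeomorph.smulOfNeZero r hr.ne').toMeasurableEquiv).symm
  rw [h, Measure.map_addHaar_smul μ hr.ne', lintegral_smul_measure, smul_eq_mul, ← mul_assoc,
    ← ENNReal.ofReal_mul hpos.le, abs_of_pos (by positivity), mul_inv_cancel₀ hpos.ne',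
    ENNReal.ofReal_one, one_mul]

theorem lintegral_Ioi_comp_inv (f : ℝ → ℝ≥0∞) :
    ∫⁻ t in Ioi (0 : ℝ), f t = ∫⁻ s in Ioi (0 : ℝ), ENNReal.ofReal ((s ^ 2)⁻¹) * f s⁻¹ := by
  have himg : (fun s : ℝ => s⁻¹) '' Ioi 0 = Ioi 0 := by
    ext x
    constructor
    · rintro ⟨s, hs, rfl⟩; exact inv_pos.2 (mem_Ioi.1 hs)
    · exact fun hx => ⟨x⁻¹, inv_pos.2 (mem_Ioi.1 hx), inv_inv x⟩
  have h := lintegral_image_eq_lintegral_abs_deriv_mul (s := Ioi (0 : ℝ)) (f := fun s : ℝ => s⁻¹)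
    (f' := fun s => -(s ^ 2)⁻¹) measurableSet_Ioi
    (fun x hx => (hasDerivAt_inv (ne_of_gt hx)).hasDerivWithinAt) (inv_injective.injOn) f
  rw [himg] at h
  rw [h]
  refine lintegral_congr fun s => ?_
  rw [abs_neg, abs_of_nonneg (by positivity)]

theorem lintegral_eq_two_mul_setLIntegral_Ioi_of_even {f : ℝ → ℝ≥0∞} (hf : ∀ t, f (-t) = f t) :
    ∫⁻ t, f t = 2 * ∫⁻ t in Ioi (0 : ℝ), f t := by
  have h : ∫⁻ t in Iio (0 : ℝ), f t = ∫⁻ t in Ioi (0 : ℝ), f t := by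
    have := (Measure.measurePreserving_neg (volume : Measure ℝ)).setLIntegral_comp_preimage_emb
      (MeasurableEquiv.neg ℝ).measurableEmbedding f (Ioi 0)
    simpa [hf] using this
  rw [← lintegral_add_compl f measurableSet_Ioi, compl_Ioi, setLIntegral_congr Iio_ae_eq_Iic.symm, h,
    two_mul]

/-- Homogeneous concavity of order `-1/p` of an extended nonnegative function. With the conventions
`0 ^ (-1/p) = ∞` and `∞ ^ (-1/p) = 0` no positivity assumption is needed. -/
def ENNRealNegConcave {V : Type*} [AddCommGroup V] [Module ℝ V] (p : ℝ) (φ : V → ℝ≥0∞) : Prop :=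
  ∀ x y : V, ∀ a b : ℝ, 0 < a → 0 < b → a + b = 1 →
    φ (a • x + b • y) ^ (-p⁻¹) ≤
      ENNReal.ofReal a * φ x ^ (-p⁻¹) + ENNReal.ofReal b * φ y ^ (-p⁻¹)

section Rays

variable {V : Type*} [NormedAddCommGroup V] [InnerProductSpace ℝ V]

/-- The integral of `φ` over the half-space `{t • u + e w | t > 0}`, in the coordinates `(t, w)`. -/
noncomputable def halfSpaceIntegral {m : ℕ} (φ : V → ℝ≥0∞) (e : (Fin m → ℝ) →L[ℝ] V) (u : V) :
    ℝ≥0∞ :=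
  ∫⁻ t in Ioi (0 : ℝ), ∫⁻ w, φ (t • u + e w)

/-- The integrand of `halfSpaceIntegral φ e u` in the projective coordinates `(1 / t, w / t)`. -/
noncomputable def projectiveIntegrand {m : ℕ} (φ : V → ℝ≥0∞) (e : (Fin m → ℝ) →L[ℝ] V) (u : V)
    (q : ℝ × (Fin m → ℝ)) : ℝ≥0∞ :=
  if 0 < q.1 then ENNReal.ofReal (q.1⁻¹ ^ (m + 2)) * φ (q.1⁻¹ • (u + e q.2)) else 0

/-- In projective coordinates the concavity of `φ` becomes subadditivity, jointly in `u` and in the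
coordinates. -/
theorem projectiveIntegrand_add_le {m : ℕ} {φ : V → ℝ≥0∞}
    (hφt : ∀ x, φ x ≠ ∞) (hc : ENNRealNegConcave (m + 2 : ℝ) φ) (e : (Fin m → ℝ) →L[ℝ] V)
    (u v : V) (q r : ℝ × (Fin m → ℝ)) :
    projectiveIntegrand φ e (u + v) (q + r) ^ (-(m + 2 : ℝ)⁻¹) ≤
      projectiveIntegrand φ e u q ^ (-(m + 2 : ℝ)⁻¹) +
        projectiveIntegrand φ e v r ^ (-(m + 2 : ℝ)⁻¹) := by
  have hp : (0 : ℝ) < m + 2 := by positivity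
  have hneg : -(m + 2 : ℝ)⁻¹ < 0 := by simpa using hp
  have hscale : ∀ {s : ℝ} (x : V), 0 < s →
      (ENNReal.ofReal (s⁻¹ ^ (m + 2)) * φ x) ^ (-(m + 2 : ℝ)⁻¹) =
        ENNReal.ofReal s * φ x ^ (-(m + 2 : ℝ)⁻¹) := by
    intro s x hs
    rw [ENNReal.mul_rpow_of_ne_top ENNReal.ofReal_ne_top (hφt x),
      ENNReal.ofReal_rpow_of_pos (by positivity), ← Real.rpow_natCast, ← Real.rpow_mul (by positivity)]
    congr 2
    push_cast
    rw [mul_neg, mul_inv_cancel₀ hp.ne', Real.rpow_neg_one, inv_inv]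
  rcases q with ⟨s, w⟩
  rcases r with ⟨t, x⟩
  by_cases hs : 0 < s
  swap
  · simp [projectiveIntegrand, hs, ENNReal.zero_rpow_of_neg hneg]
  by_cases ht : 0 < t
  swap
  · simp [projectiveIntegrand, ht, ENNReal.zero_rpow_of_neg hneg]
  have hst : 0 < s + t := add_pos hs ht
  simp only [projectiveIntegrand, Prod.mk_add_mk, if_pos hs, if_pos ht, if_pos hst]
  rw [hscale _ hs, hscale _ ht, hscale _ hst]
  -- The argument of `φ` on the left is a convex combination of those on the right, with weights
  -- proportional to `s` and `t`.
  have hcomb : (s + t)⁻¹ • (u + v + e (w + x)) =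
      (s / (s + t)) • (s⁻¹ • (u + e w)) + (t / (s + t)) • (t⁻¹ • (v + e x)) := by
    rw [smul_smul, smul_smul, map_add, show s / (s + t) * s⁻¹ = (s + t)⁻¹ by field_simp,
      show t / (s + t) * t⁻¹ = (s + t)⁻¹ by field_simp, ← smul_add]
    congr 1
    abel
  have h := hc (s⁻¹ • (u + e w)) (t⁻¹ • (v + e x)) (s / (s + t)) (t / (s + t)) (by positivity)
    (by positivity) (by field_simp)
  rw [← hcomb] at h
  calc _ ≤ ENNReal.ofReal (s + t) * _ := mul_le_mul_right h _
    _ = _ := by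
      rw [mul_add, ← mul_assoc, ← mul_assoc, ← ENNReal.ofReal_mul hst.le,
        ← ENNReal.ofReal_mul hst.le, mul_div_cancel₀ _ hst.ne', mul_div_cancel₀ _ hst.ne']

variable [MeasurableSpace V] [BorelSpace V] [FiniteDimensional ℝ V]

theorem measurable_projectiveIntegrand {m : ℕ} {φ : V → ℝ≥0∞} (hφ : Measurable φ)
    (e : (Fin m → ℝ) →L[ℝ] V) (u : V) : Measurable (projectiveIntegrand φ e u) := by
  unfold projectiveIntegrand
  refine Measurable.ite (measurableSet_lt measurable_const measurable_fst) ?_ measurable_const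
  have he : Measurable fun q : ℝ × (Fin m → ℝ) => e q.2 := (e.continuous.comp continuous_snd).measurable
  refine Measurable.mul (by fun_prop) (hφ.comp ?_)
  exact measurable_fst.inv.smul (he.const_add u)

theorem halfSpaceIntegral_eq_lintegral_projectiveIntegrand {m : ℕ} {φ : V → ℝ≥0∞}
    (hφ : Measurable φ) (e : (Fin m → ℝ) →L[ℝ] V) (u : V) :
    halfSpaceIntegral φ e u =
      ∫⁻ q, projectiveIntegrand φ e u q ∂((volume : Measure ℝ).prod volume) := by
  have he : Measurable e := e.continuous.measurable
  rw [lintegral_prod _ (measurable_projectiveIntegrand hφ e u).aemeasurable, halfSpaceIntegral,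
    lintegral_Ioi_comp_inv, ← lintegral_indicator measurableSet_Ioi]
  refine lintegral_congr fun s => ?_
  by_cases hs : 0 < s
  · have hs' : 0 < s⁻¹ := inv_pos.2 hs
    rw [indicator_of_mem (mem_Ioi.2 hs), ← lintegral_comp_smul volume _ hs', ← mul_assoc,
      ← ENNReal.ofReal_mul (by positivity), ← lintegral_const_mul]
    · refine lintegral_congr fun w => ?_
      simp only [projectiveIntegrand, if_pos hs, map_smul, smul_add]
      congr 2
      rw [Module.finrank_fin_fun]
      ring
    · exact hφ.comp ((he.comp (measurable_const_smul _)).const_add _)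
  · rw [indicator_of_notMem (by simpa using hs)]
    simp [projectiveIntegrand, hs]

/-- Busemann's inequality for half-spaces with a common boundary. -/
theorem inv_halfSpaceIntegral_add_le {m : ℕ} {φ : V → ℝ≥0∞} (hφ : Measurable φ)
    (hφt : ∀ x, φ x ≠ ∞) (hc : ENNRealNegConcave (m + 2 : ℝ) φ) (e : (Fin m → ℝ) →L[ℝ] V)
    (u v : V) :
    (halfSpaceIntegral φ e (u + v))⁻¹ ≤ (halfSpaceIntegral φ e u)⁻¹ + (halfSpaceIntegral φ e v)⁻¹ := by
  have hBBL := (BorellBrascampLieb.real.prod (BorellBrascampLieb.pi m)) (m + 2 : ℝ)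
    (by push_cast; linarith) _ _ _ (measurable_projectiveIntegrand hφ e u)
    (measurable_projectiveIntegrand hφ e v) (measurable_projectiveIntegrand hφ e (u + v))
    (projectiveIntegrand_add_le hφt hc e u v)
  simp only [← halfSpaceIntegral_eq_lintegral_projectiveIntegrand hφ] at hBBL
  -- In dimension `m + 1` the exponent `p = m + 2` drops to `1`.
  have hexp : -((m + 2 : ℝ) - (1 + m : ℕ))⁻¹ = -1 := by
    push_cast
    rw [show (m + 2 : ℝ) - (1 + m) = 1 by ring, inv_one]
  simpa only [hexp, ENNReal.rpow_neg_one] using hBBL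

theorem OrthonormalBasis.lintegral_eq_lintegral_lintegral {m : ℕ}
    (b : OrthonormalBasis (Fin (m + 1)) ℝ V) {g : V → ℝ≥0∞} (hg : Measurable g) :
    ∫⁻ x, g x = ∫⁻ t : ℝ, ∫⁻ w : Fin m → ℝ, g (t • b 0 + ∑ i, w i • b i.succ) := by
  have hT := (b.measurePreserving_repr_symm.comp
    (EuclideanSpace.volume_preserving_symm_measurableEquiv_toLp (Fin (m + 1))).symm).comp
      (volume_preserving_piFinSuccAbove (fun _ : Fin (m + 1) => ℝ) 0).symm
  rw [← hT.lintegral_comp hg]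
  refine (lintegral_prod _ (hg.comp hT.measurable).aemeasurable).trans ?_
  refine lintegral_congr fun t => lintegral_congr fun w => congrArg g ?_
  simp [← OrthonormalBasis.sum_repr_symm, Fin.sum_univ_succ, MeasurableEquiv.piFinSuccAbove]

/-- The integral over `zᗮ`, in an orthonormal basis of `zᗮ` given by the direction of `u` and by a
fixed orthonormal family. -/
theorem lintegral_orthogonal_eq_mul_halfSpaceIntegral {m : ℕ} (hm : Module.finrank ℝ V = m + 2)
    {φ : V → ℝ≥0∞} (hφ : Measurable φ) (heven : ∀ x, φ (-x) = φ x) {v : Fin m → V}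
    (hv : Orthonormal ℝ v) {z u : V} (hz : z ≠ 0) (hu : ‖u‖ = ‖z‖) (hzu : inner ℝ z u = 0)
    (hzv : ∀ i, inner ℝ z (v i) = 0) (huv : ∀ i, inner ℝ u (v i) = 0)
    {e : (Fin m → ℝ) →L[ℝ] V} (he : ∀ w, e w = ∑ i, w i • v i) :
    ∫⁻ x : (ℝ ∙ z)ᗮ, φ x ∂(@volume _ measureSpaceOfInnerProductSpace) =
      ENNReal.ofReal ‖z‖ * (2 * halfSpaceIntegral φ e u) := by
  have hz0 : 0 < ‖z‖ := norm_pos_iff.2 hz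
  have hmem : ∀ x, inner ℝ z x = 0 → x ∈ (ℝ ∙ z)ᗮ := fun x hx =>
    Submodule.mem_orthogonal_singleton_iff_inner_right.2 hx
  let y : Fin (m + 1) → (ℝ ∙ z)ᗮ := Fin.cons
    ⟨‖z‖⁻¹ • u, hmem _ (by rw [inner_smul_right, hzu, mul_zero])⟩ fun i => ⟨v i, hmem _ (hzv i)⟩
  have hy : Orthonormal ℝ y := by
    constructor
    · refine Fin.cases ?_ fun i => ?_
      · simp [y, norm_smul, hu, hz0.ne']
      · simpa [y] using hv.1 i
    · refine fun i => Fin.cases ?_ (fun i => ?_) i <;> refine fun j => Fin.cases ?_ (fun j => ?_) j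
      · simp
      · simp [y, inner_smul_left, huv]
      · simp [y, inner_smul_right, real_inner_comm, huv]
      · intro hij
        simpa [y] using hv.2 (fun h => hij (congrArg _ h))
  have hrank : Module.finrank ℝ (ℝ ∙ z)ᗮ = m + 1 := by
    have h1 := Submodule.finrank_add_finrank_orthogonal (ℝ ∙ z)
    rw [finrank_span_singleton hz, hm] at h1
    omega
  obtain ⟨b, hb⟩ := Orthonormal.exists_orthonormalBasis_extension_of_card_eq (ι := Fin (m + 1))
    (by simpa using hrank) (v := y) (s := univ) (hy.comp _ Subtype.val_injective)
  have hb0 : (b 0 : V) = ‖z‖⁻¹ • u := by rw [hb 0 (mem_univ _)]; rfl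
  have hbs : ∀ i : Fin m, (b i.succ : V) = v i := fun i => by rw [hb _ (mem_univ _)]; rfl
  refine (b.lintegral_eq_lintegral_lintegral (hφ.comp measurable_subtype_coe)).trans ?_
  have h1 : ∀ t : ℝ, ∀ w : Fin m → ℝ,
      φ ((t • b 0 + ∑ i, w i • b i.succ : (ℝ ∙ z)ᗮ) : V) = φ ((t * ‖z‖⁻¹) • u + e w) := by
    intro t w
    rw [he]
    push_cast
    simp only [hb0, hbs, smul_smul]
  simp only [Function.comp_apply, h1]
  rw [← lintegral_comp_smul volume _ hz0, Module.finrank_self, pow_one]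
  congr 1
  -- Replacing `t` by `‖z‖ * t` replaces the unit vector `u / ‖z‖` by `u`.
  have h2 : ∀ t : ℝ, ‖z‖ • t * ‖z‖⁻¹ = t := fun t => by simp [mul_comm ‖z‖, hz0.ne']
  simp only [h2]
  refine lintegral_eq_two_mul_setLIntegral_Ioi_of_even fun t => ?_
  have := (Measure.measurePreserving_neg (volume : Measure (Fin m → ℝ))).lintegral_comp_emb
    (MeasurableEquiv.neg (Fin m → ℝ)).measurableEmbedding fun w => φ (-t • u + e w)
  rw [← this]
  refine lintegral_congr fun w => ?_
  rw [map_neg, neg_smul, ← neg_add, heven]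

end Rays

/-! ### Regularization of the density -/

section InteriorDensity

variable {V : Type*} [TopologicalSpace V]

/-- The measurable representative of `ψ` obtained by discarding the values on the boundary of
`{ψ > 0}`. -/
noncomputable def interiorDensity (ψ : V → ℝ) : V → ℝ≥0∞ :=
  (interior {x | 0 < ψ x}).indicator fun x => ENNReal.ofReal (ψ x)

theorem interiorDensity_ne_top (ψ : V → ℝ) (x : V) : interiorDensity ψ x ≠ ∞ := by
  unfold interiorDensity indicator
  split_ifs <;> simp

theorem pos_of_mem_interior_pos {ψ : V → ℝ} {x : V} (hx : x ∈ interior {x | 0 < ψ x}) : 0 < ψ x :=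
  @interior_subset _ _ {x | 0 < ψ x} _ hx

theorem interiorDensity_neg [InvolutiveNeg V] [ContinuousNeg V] {ψ : V → ℝ}
    (heven : ∀ x, ψ (-x) = ψ x) (x : V) :
    interiorDensity ψ (-x) = interiorDensity ψ x := by
  have h := (Homeomorph.neg V).preimage_interior {x | 0 < ψ x}
  have hpre : Homeomorph.neg V ⁻¹' {x | 0 < ψ x} = {x | 0 < ψ x} := by
    ext x
    simp [heven]
  rw [hpre] at h
  have h' : -x ∈ interior {x | 0 < ψ x} ↔ x ∈ interior {x | 0 < ψ x} := Set.ext_iff.1 h x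
  by_cases hx : x ∈ interior {x | 0 < ψ x}
  · rw [interiorDensity, indicator_of_mem hx, indicator_of_mem (h'.2 hx), heven]
  · rw [interiorDensity, indicator_of_notMem hx, indicator_of_notMem (mt h'.1 hx)]

end InteriorDensity

theorem ennrealNegConcave_interiorDensity {V : Type*} [NormedAddCommGroup V]
    [NormedSpace ℝ V] {ψ : V → ℝ} {p : ℝ} (hp : 0 < p)
    (hc : ConvexOn ℝ {x | 0 < ψ x} fun x => ψ x ^ (-p⁻¹)) :
    ENNRealNegConcave p (interiorDensity ψ) := by
  have hneg : -p⁻¹ < 0 := by simpa using hp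
  have hpow : ∀ {x}, x ∈ interior {x | 0 < ψ x} →
      interiorDensity ψ x ^ (-p⁻¹) = ENNReal.ofReal (ψ x ^ (-p⁻¹)) := by
    intro x hx
    rw [interiorDensity, indicator_of_mem hx, ENNReal.ofReal_rpow_of_pos (pos_of_mem_interior_pos hx)]
  have hzero : ∀ {x}, x ∉ interior {x | 0 < ψ x} → interiorDensity ψ x ^ (-p⁻¹) = ∞ := by
    intro x hx
    rw [interiorDensity, indicator_of_notMem hx, ENNReal.zero_rpow_of_neg hneg]
  intro x y a b ha hb hab
  by_cases hx : x ∈ interior {x | 0 < ψ x}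
  swap
  · rw [hzero hx, ENNReal.mul_top (by simpa using ha), top_add]; exact le_top
  by_cases hy : y ∈ interior {x | 0 < ψ x}
  swap
  · rw [hzero hy, ENNReal.mul_top (by simpa using hb), add_top]; exact le_top
  have hx0 : 0 < ψ x := pos_of_mem_interior_pos hx
  have hy0 : 0 < ψ y := pos_of_mem_interior_pos hy
  rw [hpow hx, hpow hy, hpow (hc.1.interior hx hy ha.le hb.le hab), ← ENNReal.ofReal_mul ha.le,
    ← ENNReal.ofReal_mul hb.le, ← ENNReal.ofReal_add (by positivity) (by positivity)]
  exact ENNReal.ofReal_le_ofReal (hc.2 hx0 hy0 ha.le hb.le hab)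

theorem lintegral_interiorDensity_submodule_pos {V : Type*} [NormedAddCommGroup V]
    [NormedSpace ℝ V] [MeasurableSpace V] {ψ : V → ℝ} (hm : Measurable (interiorDensity ψ))
    (h0 : (0 : V) ∈ interior {x | 0 < ψ x}) (W : Submodule ℝ V) (μ : Measure W)
    [μ.IsAddHaarMeasure] : 0 < ∫⁻ x : W, interiorDensity ψ x ∂μ := by
  refine (lintegral_pos_iff_support (hm.comp measurable_subtype_coe)).2 ?_
  refine ((isOpen_interior.preimage continuous_subtype_val).measure_pos μ
    ⟨(0 : W), h0⟩).trans_le (measure_mono fun x hx => ?_)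
  have hx' : (x : V) ∈ interior {x | 0 < ψ x} := hx
  have hx0 : 0 < ψ x := pos_of_mem_interior_pos hx'
  simpa [Function.mem_support, interiorDensity, indicator_of_mem hx'] using hx0

section Regularization

variable {V : Type*} [NormedAddCommGroup V] [InnerProductSpace ℝ V] [MeasurableSpace V]
  [BorelSpace V] [FiniteDimensional ℝ V]

/-- A symmetric convex set of positive measure is a neighbourhood of the origin. -/
theorem Convex.zero_mem_interior_of_measure_ne_zero (μ : Measure V) [μ.IsAddHaarMeasure] {C : Set V}
    (hC : Convex ℝ C) (hsymm : ∀ x ∈ C, -x ∈ C) (hμ : μ C ≠ 0) : (0 : V) ∈ interior C := by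
  have hne : (interior C).Nonempty := by
    by_contra h
    rw [not_nonempty_iff_eq_empty] at h
    refine hμ (measure_mono_null ?_ (hC.addHaar_frontier μ))
    rw [frontier, h, sdiff_empty]
    exact subset_closure
  obtain ⟨x, hx⟩ := hne
  have hx' : -x ∈ C := hsymm x (interior_subset hx)
  have := hC.combo_interior_self_mem_interior hx hx' (show (0 : ℝ) < 1 / 2 by norm_num)
    (show (0 : ℝ) ≤ 1 / 2 by norm_num) (by norm_num)
  simpa using this

/-- If the origin is interior to the convex set `C`, then almost every point of the section of `C`
by a subspace is interior to `C`: the other points lie on the frontier of the section of the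
interior. -/
theorem Convex.ae_mem_interior_of_mem_submodule {C : Set V} (hC : Convex ℝ C)
    (h0 : (0 : V) ∈ interior C) (W : Submodule ℝ V) (μ : Measure W) [μ.IsAddHaarMeasure] :
    ∀ᵐ x : W ∂μ, (x : V) ∈ C → (x : V) ∈ interior C := by
  set U : Set W := W.subtype ⁻¹' interior C with hU
  have hUo : IsOpen U := isOpen_interior.preimage continuous_subtype_val
  have hUc : Convex ℝ U := hC.interior.linear_preimage W.subtype
  filter_upwards [measure_eq_zero_iff_ae_notMem.1 (hUc.addHaar_frontier μ)] with x hx hxC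
  by_contra hxi
  refine hx ⟨?_, ?_⟩
  · -- The points `t • x` with `0 ≤ t < 1` are interior to `C` and converge to `x`.
    have h1 : (1 : ℝ) ∈ closure (Ico (0 : ℝ) 1) := by
      rw [closure_Ico (by norm_num)]; simp
    have := map_mem_closure (f := fun t : ℝ => t • x) (t := U) (by fun_prop) h1 fun t ht => by
      have := hC.combo_interior_self_mem_interior h0 hxC (sub_pos.2 ht.2) ht.1 (by ring)
      simpa [hU] using this
    simpa using this
  · rw [hUo.interior_eq]
    exact hxi

variable {ψ : V → ℝ} {p : ℝ}

theorem measurable_interiorDensity (hp : 0 < p)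
    (hc : ConvexOn ℝ {x | 0 < ψ x} fun x => ψ x ^ (-p⁻¹)) : Measurable (interiorDensity ψ) := by
  classical
  have hcont : ContinuousOn ψ (interior {x | 0 < ψ x}) := by
    have h1 : ContinuousOn (fun x => (ψ x ^ (-p⁻¹)) ^ (-p)) (interior {x | 0 < ψ x}) :=
      hc.continuousOn_interior.rpow_const fun x hx =>
        Or.inl (Real.rpow_pos_of_pos (pos_of_mem_interior_pos hx) _).ne'
    refine h1.congr fun x hx => ?_
    dsimp only
    have hx0 : 0 < ψ x := pos_of_mem_interior_pos hx
    rw [← Real.rpow_mul hx0.le, neg_mul_neg, inv_mul_cancel₀ hp.ne', Real.rpow_one]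
  rw [interiorDensity, ← piecewise_eq_indicator]
  exact (ENNReal.continuous_ofReal.comp_continuousOn hcont).measurable_piecewise
    continuousOn_const isOpen_interior.measurableSet

theorem lintegral_interiorDensity_submodule (hc : Convex ℝ {x | 0 < ψ x})
    (h0 : (0 : V) ∈ interior {x | 0 < ψ x}) (W : Submodule ℝ V) (μ : Measure W)
    [μ.IsAddHaarMeasure] :
    ∫⁻ x : W, interiorDensity ψ x ∂μ = ∫⁻ x : W, ENNReal.ofReal (ψ x) ∂μ := by
  refine lintegral_congr_ae ?_
  filter_upwards [hc.ae_mem_interior_of_mem_submodule h0 W μ] with x hx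
  by_cases hi : (x : V) ∈ interior {x | 0 < ψ x}
  · rw [interiorDensity, indicator_of_mem hi]
  · rw [interiorDensity, indicator_of_notMem hi, eq_comm, ENNReal.ofReal_eq_zero]
    exact not_lt.1 fun h => hi (hx h)

end Regularization

/-! ### Busemann's inequality for hyperplane sections -/

section Triangle

variable {V : Type*} [NormedAddCommGroup V] [InnerProductSpace ℝ V] [MeasurableSpace V]
  [BorelSpace V] [FiniteDimensional ℝ V]

/-- Busemann's inequality for two linearly independent vectors. -/
theorem div_lintegral_orthogonal_add_le {φ : V → ℝ≥0∞} (hφ : Measurable φ) (hφt : ∀ x, φ x ≠ ∞)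
    (heven : ∀ x, φ (-x) = φ x) (hc : ENNRealNegConcave (Module.finrank ℝ V) φ) {y z : V}
    (hyz : LinearIndependent ℝ ![y, z]) :
    ENNReal.ofReal ‖y + z‖ /
        ∫⁻ x : (ℝ ∙ (y + z))ᗮ, φ x ∂(@volume _ measureSpaceOfInnerProductSpace) ≤
      ENNReal.ofReal ‖y‖ / ∫⁻ x : (ℝ ∙ y)ᗮ, φ x ∂(@volume _ measureSpaceOfInnerProductSpace) +
      ENNReal.ofReal ‖z‖ / ∫⁻ x : (ℝ ∙ z)ᗮ, φ x ∂(@volume _ measureSpaceOfInnerProductSpace) := by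
  set P := Submodule.span ℝ (range ![y, z]) with hP
  have hP2 : Module.finrank ℝ P = 2 := by
    rw [hP, finrank_span_eq_card hyz, Fintype.card_fin]
  have : Fact (Module.finrank ℝ P = 2) := ⟨hP2⟩
  let J := (Module.finBasisOfFinrankEq ℝ P hP2).orientation.rightAngleRotation
  have hJ : ∀ x : P, inner ℝ (x : V) (J x : V) = 0 := fun x =>
    (real_inner_comm _ _).trans (Orientation.inner_rightAngleRotation_self _ x)
  obtain ⟨m, hm⟩ : ∃ m, Module.finrank ℝ Pᗮ = m := ⟨_, rfl⟩
  have hV : Module.finrank ℝ V = m + 2 := by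
    rw [← Submodule.finrank_add_finrank_orthogonal P, hP2, hm, add_comm]
  let b := (stdOrthonormalBasis ℝ Pᗮ).reindex (finCongr hm)
  let v : Fin m → V := fun i => b i
  have hv : Orthonormal ℝ v := b.orthonormal.comp_linearIsometry Pᗮ.subtypeₗᵢ
  let e : (Fin m → ℝ) →L[ℝ] V := (Fintype.linearCombination ℝ v).toContinuousLinearMap
  have hPv : ∀ (x : P) i, inner ℝ (x : V) (v i) = 0 := fun x i =>
    Submodule.inner_right_of_mem_orthogonal x.2 (b i).2
  -- The factor `‖x‖` cancels against the length of `J x`, which leaves a function of `J x` alone.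
  have hform : ∀ x : P, (x : V) ≠ 0 → ENNReal.ofReal ‖(x : V)‖ /
      ∫⁻ w : (ℝ ∙ (x : V))ᗮ, φ w ∂(@volume _ measureSpaceOfInnerProductSpace) =
        2⁻¹ * (halfSpaceIntegral φ e (J x : V))⁻¹ := by
    intro x hx
    have hx0 : ENNReal.ofReal ‖(x : V)‖ ≠ 0 := by simpa using hx
    rw [lintegral_orthogonal_eq_mul_halfSpaceIntegral hV hφ heven hv hx (u := (J x : V))
      (J.norm_map x) (hJ x) (hPv x) (hPv (J x)) (e := e)
      (fun w => Fintype.linearCombination_apply ℝ v w),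
      ENNReal.div_eq_inv_mul, ENNReal.mul_inv (Or.inl hx0) (Or.inl ENNReal.ofReal_ne_top),
      mul_right_comm, ENNReal.inv_mul_cancel hx0 ENNReal.ofReal_ne_top, one_mul,
      ENNReal.mul_inv (by simp) (by simp)]
  have hy : y ∈ P := Submodule.subset_span ⟨0, rfl⟩
  have hz : z ∈ P := Submodule.subset_span ⟨1, rfl⟩
  have hy0 : y ≠ 0 := hyz.ne_zero 0
  have hz0 : z ≠ 0 := hyz.ne_zero 1
  have hyz0 : y + z ≠ 0 := fun h => by
    have := LinearIndependent.pair_iff.1 hyz 1 1 (by simpa using h)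
    simp at this
  have h1 := hform ⟨y, hy⟩ hy0
  have h2 := hform ⟨z, hz⟩ hz0
  have h3 := hform (⟨y, hy⟩ + ⟨z, hz⟩) hyz0
  simp only [Submodule.coe_add, map_add] at h1 h2 h3
  rw [h1, h2, h3, ← mul_add]
  refine mul_le_mul_right (inv_halfSpaceIntegral_add_le hφ hφt ?_ e _ _) _
  rw [hV] at hc
  exact_mod_cast hc

end Triangle

section Busemann

variable {n : ℕ} {ψ : EuclideanSpace ℝ (Fin n) → ℝ}

theorem busemannFun_smul (ψ : EuclideanSpace ℝ (Fin n) → ℝ) (c : ℝ) (z : EuclideanSpace ℝ (Fin n)) :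
    busemannFun ψ (c • z) = ENNReal.ofReal ‖c‖ * busemannFun ψ z := by
  rcases eq_or_ne c 0 with rfl | hc
  · simp [busemannFun]
  rcases eq_or_ne z 0 with rfl | hz
  · simp [busemannFun]
  have hspan : (ℝ ∙ (c • z)) = ℝ ∙ z := Submodule.span_singleton_smul_eq (IsUnit.mk0 c hc) z
  rw [busemannFun, busemannFun, if_neg (smul_ne_zero hc hz), if_neg hz, norm_smul,
    ENNReal.ofReal_mul (norm_nonneg _), mul_div_assoc]
  exact congrArg (fun W : Submodule ℝ (EuclideanSpace ℝ (Fin n)) => ENNReal.ofReal ‖c‖ *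
    (ENNReal.ofReal ‖z‖ / ∫⁻ x : Wᗮ, ENNReal.ofReal (ψ x)
      ∂(@volume _ measureSpaceOfInnerProductSpace))) hspan

theorem busemannFun_add_le (hψ : ∀ x, ψ (-x) = ψ x) (hn : 1 ≤ n)
    (hc : ConvexOn ℝ {x | 0 < ψ x} fun x => ψ x ^ (-(n : ℝ)⁻¹))
    (h0 : (0 : EuclideanSpace ℝ (Fin n)) ∈ interior {x | 0 < ψ x}) (y z : EuclideanSpace ℝ (Fin n)) :
    busemannFun ψ (y + z) ≤ busemannFun ψ y + busemannFun ψ z := by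
  have hn0 : (0 : ℝ) < n := by exact_mod_cast hn
  by_cases hyz : LinearIndependent ℝ ![y, z]
  · have hy0 : y ≠ 0 := hyz.ne_zero 0
    have hz0 : z ≠ 0 := hyz.ne_zero 1
    have hyz0 : y + z ≠ 0 := fun h => by
      have := LinearIndependent.pair_iff.1 hyz 1 1 (by simpa using h)
      simp at this
    simp only [busemannFun, if_neg hy0, if_neg hz0, if_neg hyz0, hyperplaneMeasure,
      ← lintegral_interiorDensity_submodule hc.1 h0]
    refine div_lintegral_orthogonal_add_le (measurable_interiorDensity hn0 hc)
      (interiorDensity_ne_top ψ) (interiorDensity_neg hψ) ?_ hyz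
    rw [finrank_euclideanSpace_fin]
    exact ennrealNegConcave_interiorDensity hn0 hc
  · rcases eq_or_ne y 0 with rfl | hy0
    · rw [zero_add]; exact le_add_self
    · rw [LinearIndependent.pair_iff' hy0] at hyz
      push Not at hyz
      obtain ⟨a, rfl⟩ := hyz
      have h1 : y + a • y = (1 + a) • y := by rw [add_smul, one_smul]
      rw [h1, busemannFun_smul, busemannFun_smul ψ a]
      calc ENNReal.ofReal ‖1 + a‖ * busemannFun ψ y
          ≤ ENNReal.ofReal (1 + ‖a‖) * busemannFun ψ y := by
            gcongr
            simpa using norm_add_le (1 : ℝ) a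
        _ = busemannFun ψ y + ENNReal.ofReal ‖a‖ * busemannFun ψ y := by
            rw [ENNReal.ofReal_add zero_le_one (norm_nonneg a), add_mul, ENNReal.ofReal_one,
              one_mul]

theorem busemannFun_ne_top (hn : 1 ≤ n)
    (hc : ConvexOn ℝ {x | 0 < ψ x} fun x => ψ x ^ (-(n : ℝ)⁻¹))
    (h0 : (0 : EuclideanSpace ℝ (Fin n)) ∈ interior {x | 0 < ψ x}) (z : EuclideanSpace ℝ (Fin n)) :
    busemannFun ψ z ≠ ∞ := by
  have hn0 : (0 : ℝ) < n := by exact_mod_cast hn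
  rcases eq_or_ne z 0 with rfl | hz
  · simp [busemannFun]
  rw [busemannFun, if_neg hz, hyperplaneMeasure, ← lintegral_interiorDensity_submodule hc.1 h0]
  exact ENNReal.div_ne_top ENNReal.ofReal_ne_top
    (lintegral_interiorDensity_submodule_pos (measurable_interiorDensity hn0 hc) h0 _ _).ne'

theorem isSeminormFun_busemannFun (hψ : ∀ x, ψ (-x) = ψ x) (hn : 1 ≤ n)
    (hc : ConvexOn ℝ {x | 0 < ψ x} fun x => ψ x ^ (-(n : ℝ)⁻¹))
    (h0 : (0 : EuclideanSpace ℝ (Fin n)) ∈ interior {x | 0 < ψ x}) :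
    IsSeminormFun (busemannFun ψ) := by
  have hfin := busemannFun_ne_top hn hc h0
  refine ⟨Seminorm.of (fun z => (busemannFun ψ z).toReal) (fun y z => ?_) fun c z => ?_, fun z => ?_⟩
  · rw [← ENNReal.toReal_add (hfin y) (hfin z)]
    exact ENNReal.toReal_mono (ENNReal.add_ne_top.2 ⟨hfin y, hfin z⟩)
      (busemannFun_add_le hψ hn hc h0 y z)
  · simp [busemannFun_smul]
  · exact (ENNReal.ofReal_toReal (hfin z)).symm

theorem busemannFun_eq_zero_iff {z : EuclideanSpace ℝ (Fin n)} (hz : z ≠ 0) :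
    busemannFun ψ z = 0 ↔ hyperplaneMeasure ψ z = ∞ := by
  rw [busemannFun, if_neg hz, ENNReal.div_eq_zero_iff]
  simp [hz]

theorem IsSeminormFun.isNormFun_busemannFun_iff (h : IsSeminormFun (busemannFun ψ)) :
    IsNormFun (busemannFun ψ) ↔ ∀ z, z ≠ 0 → hyperplaneMeasure ψ z < ∞ := by
  constructor
  · rintro ⟨p, hp, hp0⟩ z hz
    refine lt_top_iff_ne_top.2 fun htop => hz (hp0 z ?_)
    have := (busemannFun_eq_zero_iff hz).2 htop
    rw [hp, ENNReal.ofReal_eq_zero] at this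
    exact le_antisymm this (apply_nonneg p z)
  · intro hfin
    obtain ⟨p, hp⟩ := h
    refine ⟨p, hp, fun z hz => by_contra fun hz0 => (hfin z hz0).ne ?_⟩
    rw [← busemannFun_eq_zero_iff hz0, hp, hz, ENNReal.ofReal_zero]

end Busemann

/-! ### Concavity of the lower density of a convex measure -/

section LowerDensity

open Filter Topology Metric

variable {n : ℕ} {ν : Measure (EuclideanSpace ℝ (Fin n))}

/-- The lower density of `ν` with respect to Lebesgue measure, computed with centred balls. -/
noncomputable def lowerDensity (ν : Measure (EuclideanSpace ℝ (Fin n)))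
    (x : EuclideanSpace ℝ (Fin n)) : ℝ≥0∞ :=
  liminf (fun r => ν (closedBall x r) / volume (closedBall x r)) (𝓝[>] (0 : ℝ))

theorem eventually_mul_le_measure_closedBall {x : EuclideanSpace ℝ (Fin n)} {a : ℝ≥0∞}
    (ha : a < lowerDensity ν x) :
    ∀ᶠ r in 𝓝[>] (0 : ℝ), a * volume (closedBall x r) ≤ ν (closedBall x r) := by
  filter_upwards [eventually_lt_of_lt_liminf ha, self_mem_nhdsWithin] with r hr hr0
  exact (ENNReal.le_div_iff_mul_le (Or.inl (measure_closedBall_pos volume x hr0).ne')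
    (Or.inl measure_closedBall_lt_top.ne)).1 hr.le

/-- Convexity of `ν`, applied to balls with radii proportional to `a ^ (-1/n)` and `b ^ (-1/n)`,
which have approximately equal measure. -/
theorem IsConvexMeasure.le_lowerDensity (hν : IsConvexMeasure ν) (hn : 1 ≤ n)
    {x y : EuclideanSpace ℝ (Fin n)} {a b s t : ℝ} (ha : 0 < a) (hb : 0 < b)
    (hax : ENNReal.ofReal a < lowerDensity ν x) (hby : ENNReal.ofReal b < lowerDensity ν y)
    (hs : 0 < s) (ht : 0 < t) (hst : s + t = 1) :
    ENNReal.ofReal ((s * a ^ (-(n : ℝ)⁻¹) + t * b ^ (-(n : ℝ)⁻¹)) ^ (-(n : ℝ))) ≤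
      lowerDensity ν (s • x + t • y) := by
  have hn0 : (n : ℝ) ≠ 0 := by positivity
  set α := a ^ (-(n : ℝ)⁻¹) with hα
  set β := b ^ (-(n : ℝ)⁻¹) with hβ
  have hα0 : 0 < α := by positivity
  have hβ0 : 0 < β := by positivity
  set m := s * α + t * β with hm
  have hm0 : 0 < m := by positivity
  have haα : a * α ^ n = 1 := by
    rw [hα, ← Real.rpow_natCast, ← Real.rpow_mul ha.le, neg_mul, inv_mul_cancel₀ hn0,
      Real.rpow_neg_one, mul_inv_cancel₀ ha.ne']
  have hbβ : b * β ^ n = 1 := by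
    rw [hβ, ← Real.rpow_natCast, ← Real.rpow_mul hb.le, neg_mul, inv_mul_cancel₀ hn0,
      Real.rpow_neg_one, mul_inv_cancel₀ hb.ne']
  have hvol : ∀ (z : EuclideanSpace ℝ (Fin n)) {r : ℝ}, 0 ≤ r → volume (closedBall z r) =
      ENNReal.ofReal (r ^ n) * volume (ball (0 : EuclideanSpace ℝ (Fin n)) 1) := fun z r hr => by
    rw [Measure.addHaar_closedBall _ z hr, finrank_euclideanSpace_fin]
  have hscale : ∀ {c : ℝ}, 0 < c → Tendsto (fun r : ℝ => r / m * c) (𝓝[>] 0) (𝓝[>] 0) := by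
    intro c hc
    refine tendsto_nhdsWithin_iff.2 ⟨?_, ?_⟩
    · have : Tendsto (fun r : ℝ => r / m * c) (𝓝 0) (𝓝 (0 / m * c)) :=
        Continuous.tendsto (by fun_prop) 0
      simpa using this.mono_left nhdsWithin_le_nhds
    · filter_upwards [self_mem_nhdsWithin] with r hr
      have : 0 < r := hr
      exact mem_Ioi.2 (by positivity)
  refine le_liminf_of_le (by isBoundedDefault) ?_
  filter_upwards [(hscale hα0).eventually (eventually_mul_le_measure_closedBall hax),
    (hscale hβ0).eventually (eventually_mul_le_measure_closedBall hby), self_mem_nhdsWithin]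
    with r h1 h2 hr
  have hr0 : 0 < r := hr
  -- With radii `r / m * α` and `r / m * β` both balls have measure at least `w`, and their
  -- Minkowski combination has radius `r`.
  set w := ENNReal.ofReal ((r / m) ^ n) * volume (ball (0 : EuclideanSpace ℝ (Fin n)) 1) with hw
  have hw0 : 0 < w := ENNReal.mul_pos (by simpa using by positivity)
    (measure_ball_pos volume _ one_pos).ne'
  rw [hvol _ (by positivity), ← mul_assoc, ← ENNReal.ofReal_mul ha.le, mul_pow, mul_left_comm, haα,
    mul_one] at h1
  rw [hvol _ (by positivity), ← mul_assoc, ← ENNReal.ofReal_mul hb.le, mul_pow, mul_left_comm, hbβ,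
    mul_one] at h2
  have hconv := hν _ _ (isCompact_closedBall x (r / m * α)) (isCompact_closedBall y (r / m * β))
    (ENNReal.mul_pos (hw0.trans_le h1).ne' (hw0.trans_le h2).ne') t ht.le (by linarith)
  have hball : (1 - t) • closedBall x (r / m * α) + t • closedBall y (r / m * β) =
      closedBall (s • x + t • y) r := by
    rw [show 1 - t = s by linarith, _root_.smul_closedBall _ _ (by positivity),
      _root_.smul_closedBall _ _ (by positivity), closedBall_add_closedBall (by positivity) (by positivity),
      Real.norm_of_nonneg hs.le, Real.norm_of_nonneg ht.le]
    congr 1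
    rw [show s * (r / m * α) + t * (r / m * β) = r / m * (s * α + t * β) by ring, ← hm]
    field_simp
  rw [hball] at hconv
  rw [ENNReal.le_div_iff_mul_le (Or.inl (measure_closedBall_pos volume _ hr0).ne')
    (Or.inl measure_closedBall_lt_top.ne)]
  refine le_trans (le_of_eq ?_) ((le_min h1 h2).trans hconv)
  rw [hvol _ hr0.le, ← mul_assoc, ← ENNReal.ofReal_mul (by positivity)]
  congr 2
  rw [Real.rpow_neg hm0.le, Real.rpow_natCast, div_pow]
  ring

theorem IsConvexMeasure.ennrealNegConcave_lowerDensity (hν : IsConvexMeasure ν) (hn : 1 ≤ n) :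
    ENNRealNegConcave (n : ℝ) (lowerDensity ν) := by
  have hn0 : (0 : ℝ) < n := by exact_mod_cast hn
  have hinv : (0 : ℝ) < (n : ℝ)⁻¹ := by positivity
  have hneg : -(n : ℝ)⁻¹ < 0 := by linarith
  intro x y s t hs ht hst
  rcases eq_or_ne (lowerDensity ν x) 0 with hx | hx
  · rw [hx, ENNReal.zero_rpow_of_neg hneg, ENNReal.mul_top (by simpa using hs), top_add]
    exact le_top
  rcases eq_or_ne (lowerDensity ν y) 0 with hy | hy
  · rw [hy, ENNReal.zero_rpow_of_neg hneg, ENNReal.mul_top (by simpa using ht), add_top]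
    exact le_top
  have : (𝓝[<] lowerDensity ν x).NeBot := nhdsLT_neBot_of_exists_lt ⟨0, pos_iff_ne_zero.2 hx⟩
  have : (𝓝[<] lowerDensity ν y).NeBot := nhdsLT_neBot_of_exists_lt ⟨0, pos_iff_ne_zero.2 hy⟩
  have hcont : Continuous fun q : ℝ≥0∞ × ℝ≥0∞ => ENNReal.ofReal s * q.1 ^ (-(n : ℝ)⁻¹) +
      ENNReal.ofReal t * q.2 ^ (-(n : ℝ)⁻¹) :=
    ((ENNReal.continuous_const_mul ENNReal.ofReal_ne_top).comp
      (ENNReal.continuous_rpow_const.comp continuous_fst)).add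
    ((ENNReal.continuous_const_mul ENNReal.ofReal_ne_top).comp
      (ENNReal.continuous_rpow_const.comp continuous_snd))
  have hlim := (hcont.tendsto (lowerDensity ν x, lowerDensity ν y)).mono_left
    ((Filter.prod_mono (nhdsWithin_le_nhds (s := Iio (lowerDensity ν x)))
      (nhdsWithin_le_nhds (s := Iio (lowerDensity ν y)))).trans_eq nhds_prod_eq.symm)
  -- By continuity it suffices to bound the right-hand side at levels below the lower densities.
  refine ge_of_tendsto hlim ?_
  filter_upwards [prod_mem_prod (Ioo_mem_nhdsLT (pos_iff_ne_zero.2 hx))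
    (Ioo_mem_nhdsLT (pos_iff_ne_zero.2 hy))]
  rintro ⟨a, b⟩ ⟨⟨ha0, hax⟩, ⟨hb0, hby⟩⟩
  dsimp only at ha0 hax hb0 hby ⊢
  have ha := ENNReal.toReal_pos ha0.ne' hax.ne_top
  have hb := ENNReal.toReal_pos hb0.ne' hby.ne_top
  have hae := ENNReal.ofReal_toReal hax.ne_top
  have hbe := ENNReal.ofReal_toReal hby.ne_top
  rw [← hae] at hax
  rw [← hbe] at hby
  have key := hν.le_lowerDensity hn ha hb hax hby hs ht hst
  rw [← hae, ← hbe]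
  refine ((ENNReal.rpow_neg_le_rpow_neg_iff hinv).2 key).trans (le_of_eq ?_)
  rw [ENNReal.ofReal_rpow_of_pos (by positivity), ENNReal.ofReal_rpow_of_pos ha,
    ENNReal.ofReal_rpow_of_pos hb, ← ENNReal.ofReal_mul hs.le, ← ENNReal.ofReal_mul ht.le,
    ← ENNReal.ofReal_add (by positivity) (by positivity), ← Real.rpow_mul (by positivity),
    neg_mul_neg, mul_inv_cancel₀ hn0.ne', Real.rpow_one]

/-- Lebesgue differentiation along centred balls. -/
theorem IsDensity.ae_eq_lowerDensity [IsLocallyFiniteMeasure ν]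
    {ψ : EuclideanSpace ℝ (Fin n) → ℝ} (hψ : IsDensity ν ψ) :
    lowerDensity ν =ᵐ[volume] fun x => ENNReal.ofReal (ψ x) := by
  have h1 := Measure.rnDeriv_withDensity₀ volume hψ.aemeasurable.ennreal_ofReal
  rw [← hψ.eq_withDensity] at h1
  filter_upwards [h1, Besicovitch.ae_tendsto_rnDeriv ν volume] with x hx hx'
  rw [← hx]
  exact hx'.liminf_eq

/-- Along each ray issuing from a point where a `-1/p`-concave function is infinite, the function
times the `p`-th power of the distance is nonincreasing in the distance. -/
theorem ENNRealNegConcave.le_mul_of_eq_top {V : Type*} [AddCommGroup V] [Module ℝ V] {p : ℝ}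
    (hp : 0 < p) {D : V → ℝ≥0∞} (hD : ENNRealNegConcave p D) {x : V} (hx : D x = ∞) {r : ℝ}
    (hr : 0 < r) (hr1 : r < 1) (w : V) : D (x + w) ≤ ENNReal.ofReal (r ^ p) * D (x + r • w) := by
  have hpi : 0 < p⁻¹ := by positivity
  have h := hD x (x + w) (1 - r) r (by linarith) hr (by ring)
  rw [show (1 - r) • x + r • (x + w) = x + r • w by module, hx,
    ENNReal.top_rpow_of_neg (by linarith), mul_zero, zero_add] at h
  refine (ENNReal.rpow_neg_le_rpow_neg_iff hpi).1 ?_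
  have hr' : ENNReal.ofReal r ≠ 0 := by simpa using hr
  rw [ENNReal.mul_rpow_eq_ite, if_neg (by simp [(Real.rpow_pos_of_pos hr p)]),
    ENNReal.ofReal_rpow_of_pos (by positivity), ← Real.rpow_mul hr.le, mul_neg,
    mul_inv_cancel₀ hp.ne', Real.rpow_neg_one, ENNReal.ofReal_inv_of_pos hr]
  calc _ ≤ (ENNReal.ofReal r)⁻¹ * (ENNReal.ofReal r * D (x + w) ^ (-p⁻¹)) := by gcongr
    _ = _ := by rw [← mul_assoc, ENNReal.inv_mul_cancel hr' ENNReal.ofReal_ne_top, one_mul]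

/-- If the lower density is infinite at `x`, then balls around `x` of all positive radii have the same
measure, so `ν` would be concentrated at `x`. -/
theorem IsConvexMeasure.lowerDensity_ne_top (hν : IsConvexMeasure ν) (hn : 1 ≤ n)
    [IsLocallyFiniteMeasure ν] (hν0 : ν ≠ 0) {ψ : EuclideanSpace ℝ (Fin n) → ℝ}
    (hψ : IsDensity ν ψ) (x : EuclideanSpace ℝ (Fin n)) : lowerDensity ν x ≠ ∞ := by
  intro hx
  have hn0 : (0 : ℝ) < n := by exact_mod_cast hn
  have : Nonempty (Fin n) := ⟨⟨0, hn⟩⟩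
  have hD := hν.ennrealNegConcave_lowerDensity hn
  have hball : ∀ R, ν (closedBall x R) =
      ∫⁻ w, (closedBall 0 R).indicator (fun w => lowerDensity ν (x + w)) w := by
    intro R
    conv_lhs => rw [hψ.eq_withDensity]
    rw [withDensity_apply _ isClosed_closedBall.measurableSet,
      ← lintegral_congr_ae (ae_restrict_of_ae hψ.ae_eq_lowerDensity),
      ← lintegral_indicator isClosed_closedBall.measurableSet,
      ← lintegral_add_left_eq_self _ x]
    refine lintegral_congr fun w => ?_
    simp [indicator, dist_eq_norm]
  have hle : ∀ R, ∀ r : ℝ, 0 < r → r < 1 → ν (closedBall x R) ≤ ν (closedBall x (r * R)) := by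
    intro R r hr hr1
    rw [hball R, hball (r * R), ← lintegral_comp_smul volume
      ((closedBall 0 (r * R)).indicator fun w => lowerDensity ν (x + w)) hr, finrank_euclideanSpace_fin,
      ← lintegral_const_mul' _ _ ENNReal.ofReal_ne_top]
    refine lintegral_mono fun w => ?_
    by_cases hw : w ∈ closedBall (0 : EuclideanSpace ℝ (Fin n)) R
    · have hw' : r • w ∈ closedBall (0 : EuclideanSpace ℝ (Fin n)) (r * R) := by
        rw [mem_closedBall_zero_iff] at hw ⊢
        rw [norm_smul, Real.norm_of_nonneg hr.le]
        gcongr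
      rw [indicator_of_mem hw, indicator_of_mem hw', ← Real.rpow_natCast]
      exact hD.le_mul_of_eq_top hn0 hx hr hr1 w
    · rw [indicator_of_notMem hw]
      exact bot_le
  -- The dimension is positive, so Lebesgue measure has no atoms.
  have hatom : ν {x} = 0 := by
    rw [hψ.eq_withDensity]
    exact withDensity_absolutelyContinuous _ _ (measure_singleton x)
  have hzero : ∀ R, ν (closedBall x R) = 0 := by
    intro R
    have h1 : Tendsto (fun r : ℝ => ν (cthickening (r * R) {x})) (𝓝[>] 0) (𝓝 (ν {x})) := by
      refine (tendsto_measure_cthickening_of_isCompact isCompact_singleton).comp ?_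
      have : Tendsto (fun r : ℝ => r * R) (𝓝 0) (𝓝 (0 * R)) := Continuous.tendsto (by fun_prop) 0
      simpa using this.mono_left nhdsWithin_le_nhds
    rw [hatom] at h1
    refine le_antisymm (ge_of_tendsto h1 ?_) bot_le
    filter_upwards [Ioo_mem_nhdsGT (show (0 : ℝ) < 1 by norm_num)] with r hr
    refine (hle R r hr.1 hr.2).trans (measure_mono ?_)
    exact closedBall_subset_cthickening_singleton x _
  refine hν0 (Measure.measure_univ_eq_zero.1 ?_)
  rw [← iUnion_closedBall_nat x]
  exact measure_iUnion_null fun k => hzero k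

theorem IsDensity.lowerDensity_neg {ψ : EuclideanSpace ℝ (Fin n) → ℝ} (hψ : IsDensity ν ψ)
    (heven : ∀ x, ψ (-x) = ψ x) (x : EuclideanSpace ℝ (Fin n)) :
    lowerDensity ν (-x) = lowerDensity ν x := by
  have hpre : ∀ r, Neg.neg ⁻¹' closedBall x r = closedBall (-x) r := fun r => by
    ext y
    rw [mem_preimage, mem_closedBall, mem_closedBall, ← dist_neg_neg, neg_neg]
  have hν : ∀ r, ν (closedBall (-x) r) = ν (closedBall x r) := by
    intro r
    rw [hψ.eq_withDensity, withDensity_apply _ isClosed_closedBall.measurableSet,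
      withDensity_apply _ isClosed_closedBall.measurableSet]
    have := (Measure.measurePreserving_neg
      (volume : Measure (EuclideanSpace ℝ (Fin n)))).setLIntegral_comp_preimage_emb
      (MeasurableEquiv.neg _).measurableEmbedding (fun y => ENNReal.ofReal (ψ y)) (closedBall x r)
    rw [hpre] at this
    simpa only [heven] using this
  have hvol : ∀ r, volume (closedBall (-x) r) = volume (closedBall x r) := fun r => by
    rw [Measure.addHaar_closedBall_center, Measure.addHaar_closedBall_center _ x]
  simp only [lowerDensity, hν, hvol]

theorem ENNRealNegConcave.convexOn_toReal_rpow {V : Type*} [AddCommGroup V] [Module ℝ V] {p : ℝ}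
    (hp : 0 < p) {D : V → ℝ≥0∞} (hD : ENNRealNegConcave p D) (ht : ∀ x, D x ≠ ∞) :
    ConvexOn ℝ {x | 0 < (D x).toReal} fun x => (D x).toReal ^ (-p⁻¹) := by
  have hneg : -p⁻¹ < 0 := by simpa using hp
  have hmem : ∀ {x}, 0 < (D x).toReal ↔ D x ≠ 0 := fun {x} => by
    simp [ENNReal.toReal_pos_iff, pos_iff_ne_zero, (ht x).lt_top]
  have hpow : ∀ {x}, D x ≠ 0 → D x ^ (-p⁻¹) = ENNReal.ofReal ((D x).toReal ^ (-p⁻¹)) := by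
    intro x hx
    rw [← ENNReal.ofReal_rpow_of_pos (hmem.2 hx), ENNReal.ofReal_toReal (ht x)]
  have hset : ∀ x, D x ≠ 0 → ∀ y, D y ≠ 0 → ∀ a b : ℝ, 0 < a → 0 < b → a + b = 1 →
      D (a • x + b • y) ≠ 0 := by
    intro x hx y hy a b ha hb hab h0
    have h := hD x y a b ha hb hab
    rw [h0, ENNReal.zero_rpow_of_neg hneg, hpow hx, hpow hy, ← ENNReal.ofReal_mul ha.le,
      ← ENNReal.ofReal_mul hb.le, top_le_iff] at h
    exact ENNReal.add_ne_top.2 ⟨ENNReal.ofReal_ne_top, ENNReal.ofReal_ne_top⟩ h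
  refine convexOn_iff_forall_pos.2 ⟨convex_iff_forall_pos.2 ?_, ?_⟩
  · exact fun x hx y hy a b ha hb hab =>
      hmem.2 (hset x (hmem.1 hx) y (hmem.1 hy) a b ha hb hab)
  · intro x hx y hy a b ha hb hab
    have hx' := hmem.1 hx
    have hy' := hmem.1 hy
    have h := hD x y a b ha hb hab
    rw [hpow hx', hpow hy', hpow (hset x hx' y hy' a b ha hb hab), ← ENNReal.ofReal_mul ha.le,
      ← ENNReal.ofReal_mul hb.le, ← ENNReal.ofReal_add (by positivity) (by positivity)] at h
    exact (ENNReal.ofReal_le_ofReal_iff (by positivity)).1 h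

theorem IsDensity.measure_pos_ne_zero {ψ : EuclideanSpace ℝ (Fin n) → ℝ} (hψ : IsDensity ν ψ)
    (hν0 : ν ≠ 0) : volume {x | 0 < ψ x} ≠ 0 := by
  intro h
  refine hν0 ?_
  rw [hψ.eq_withDensity, withDensity_eq_zero_iff hψ.aemeasurable.ennreal_ofReal]
  filter_upwards [measure_eq_zero_iff_ae_notMem.1 h] with x hx
  exact ENNReal.ofReal_eq_zero.2 (not_lt.1 hx)

/-- **Borell's theorem** in the case of even densities: the lower density of a convex measure is a
`-1/n`-concave density. -/
theorem IsConvexMeasure.exists_isGammaConcave_density (hν : IsConvexMeasure ν) (hn : 1 ≤ n)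
    [IsLocallyFiniteMeasure ν] (hν0 : ν ≠ 0) {ψ₀ : EuclideanSpace ℝ (Fin n) → ℝ}
    (hψ₀ : IsDensity ν ψ₀) (heven : ∀ x, ψ₀ (-x) = ψ₀ x) :
    ∃ ψ : EuclideanSpace ℝ (Fin n) → ℝ,
      IsDensity ν ψ ∧ (∀ x, ψ (-x) = ψ x) ∧ IsGammaConcave (-1 / (n : ℝ)) ψ := by
  have hn0 : (0 : ℝ) < n := by exact_mod_cast hn
  have hneg : -1 / (n : ℝ) < 0 := by
    rw [neg_div]; simpa using hn0
  have ht := hν.lowerDensity_ne_top hn hν0 hψ₀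
  have hdens : IsDensity ν fun x => (lowerDensity ν x).toReal := by
    refine ⟨fun x => ENNReal.toReal_nonneg, ?_, ?_⟩
    · refine hψ₀.aemeasurable.congr ?_
      filter_upwards [hψ₀.ae_eq_lowerDensity] with x hx
      rw [hx, ENNReal.toReal_ofReal (hψ₀.nonneg x)]
    · simp only [fun x => ENNReal.ofReal_toReal (ht x)]
      exact hψ₀.eq_withDensity.trans (withDensity_congr_ae hψ₀.ae_eq_lowerDensity.symm)
  refine ⟨_, hdens, fun x => by rw [hψ₀.lowerDensity_neg heven],
    fun x => ENNReal.toReal_nonneg, ?_, fun h => absurd h hneg.not_gt, fun h => absurd h hneg.ne,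
    fun _ => ?_⟩
  · obtain ⟨x, hx⟩ := nonempty_of_measure_ne_zero (hdens.measure_pos_ne_zero hν0)
    exact ⟨x, ne_of_gt hx⟩
  · rw [neg_div, one_div]
    exact (hν.ennrealNegConcave_lowerDensity hn).convexOn_toReal_rpow hn0 ht

end LowerDensity

/-! ### The theorem for convex measures with an even density -/

theorem mainTheorem4 (n : ℕ) (hn : 1 ≤ n)
    (ν : Measure (EuclideanSpace ℝ (Fin n))) [IsLocallyFiniteMeasure ν] (hν0 : ν ≠ 0)
    (hν : IsConvexMeasure ν)
    (hdens : ∃ ψ₀ : EuclideanSpace ℝ (Fin n) → ℝ, IsDensity ν ψ₀ ∧ ∀ x, ψ₀ (-x) = ψ₀ x) :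
    (∃ ψ : EuclideanSpace ℝ (Fin n) → ℝ,
      IsDensity ν ψ ∧ (∀ x, ψ (-x) = ψ x) ∧ IsGammaConcave (-1 / (n : ℝ)) ψ) ∧
    ∀ ψ : EuclideanSpace ℝ (Fin n) → ℝ,
      IsDensity ν ψ → (∀ x, ψ (-x) = ψ x) → IsGammaConcave (-1 / (n : ℝ)) ψ →
        IsSeminormFun (busemannFun ψ) ∧
        (IsNormFun (busemannFun ψ) ↔ ∀ z, z ≠ 0 → hyperplaneMeasure ψ z < ∞) := by
  obtain ⟨ψ₀, hψ₀, heven₀⟩ := hdens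
  refine ⟨hν.exists_isGammaConcave_density hn hν0 hψ₀ heven₀, fun ψ hψ heven hγ => ?_⟩
  have hn0 : (0 : ℝ) < n := by exact_mod_cast hn
  have hc : ConvexOn ℝ {x | 0 < ψ x} fun x => ψ x ^ (-(n : ℝ)⁻¹) := by
    have h := hγ.neg (by rw [neg_div]; simpa using hn0)
    rwa [neg_div, one_div] at h
  have h0 : (0 : EuclideanSpace ℝ (Fin n)) ∈ interior {x | 0 < ψ x} :=
    hc.1.zero_mem_interior_of_measure_ne_zero volume
      (fun x (hx : 0 < ψ x) => show 0 < ψ (-x) by rwa [heven]) (hψ.measure_pos_ne_zero hν0)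
  have hsemi := isSeminormFun_busemannFun heven hn hc h0
  exact ⟨hsemi, hsemi.isNormFun_busemannFun_iff⟩
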